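/- A Riemannian $n$-manifold $N$ is called $\Phi$-superstrongly unstable ($\Phi$-SSU) if, for some $q$, there is an isometric immersion of $N$ in $\mathbb R^q$ with second fundamental form $\mathsf B$ such that for every $y\in N$, every unit tangent vector $x\in T_yN$ and every orthonormal basis $e_1,\dots,e_n$ of $T_yN$, $$\mathsf F_y(x)=\sum_{\beta=1}^n\Big(4\langle \mathsf B(x,e_\beta),\mathsf B(x,e_\beta)\rangle-\langle \mathsf B(x,x),\mathsf B(e_\beta,e_\beta)\rangle\Big)<0 .$$ Manifolds and metrics are smooth, compact manifolds are without boundary, and submanifolds may be immersed and carry the induced metric. A compact convex hypersurface of $\mathbb R^q$ is the smooth boundary of a compact convex set with nonempty interior; its principal curvatures are taken with respect to the inner unit normal. (1) Let $\widetilde N$ be a compact convex hypersurface of $\mathbb R^q$ whose principal curvatures $\lambda_1\le\dots\le\lambda_{q-1}$ are positive at every point, and let $N$ be a compact minimal $k$-submanifold of $\widetilde N$. If at every point $y$ of $N$ $$\langle \operatorname{Ric}^N(x),x\rangle>\tfrac34\,k\,\lambda_{q-1}(y)^2\quad\text{for all unit tangent vectors }x\in T_yN,$$ where $\lambda_{q-1}(y)$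 is the largest principal curvature of $\widetilde N$ at (the image in $\widetilde N$ of) $y$, then $N$ is $\Phi$-SSU. (2) Let $a_1,\dots,a_q>0$ and let $N$ be a compact minimal $k$-submanifold of the ellipsoid $\{x\in\mathbb R^q:\sum_i x_i^2/a_i^2=1\}$. If $\langle \operatorname{Ric}^N(x),x\rangle>\frac34\,\frac{(\max_i a_i)^2}{(\min_i a_i)^4}\,k$ for all unit tangent vectors $x$ to $N$, then $N$ is $\Phi$-SSU. (3) Let $N$ be a compact minimal $k$-submanifold of the unit sphere $S^{q-1}\subset\mathbb R^q$. If $\langle \operatorname{Ric}^N(x),x\rangle>\frac34 k$ for all unit tangent vectors $x$ to $N$, then $N$ is $\Phi$-SSU. -/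

import Mathlib

open scoped Manifold ContDiff Topology InnerProductSpace

noncomputable section

/-- `ℝⁿ` with its standard inner product. -/
abbrev Euc (n : ℕ) : Type := EuclideanSpace ℝ (Fin n)

/-! ### Curvature of a field of inner products on an open subset of `ℝᵏ`

`G y` is the inner product at the point `y`, i.e. `G y v w = g_{ij}(y) vⁱ wʲ`. -/

section Coordinates

variable {k : ℕ}

/-- The Christoffel symbols of the Levi-Civita connection, `Γ(u, v) = Γ^l_{ij} uⁱ vʲ ∂_l`:
the vector with `G(Γ(u, v), w) = (∂_u G(v, w) + ∂_v G(u, w) - ∂_w G(u, v)) / 2` for all `w`. -/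
def christoffel (G : Euc k → Euc k →L[ℝ] Euc k →L[ℝ] ℝ) (y u v : Euc k) : Euc k :=
  (G y).inverse ((1 / 2 : ℝ) •
    (fderiv ℝ G y u v + fderiv ℝ G y v u - ((fderiv ℝ G y).flip u).flip v))

/-- The Riemann curvature tensor `R(u, v) w = ∇_u ∇_v w - ∇_v ∇_u w`, for the constant
coordinate fields `u, v, w`; `G(R(u, v) v, u)` is the sectional curvature of the plane of
`G`-orthonormal `u, v`. -/
def riemannCurvature (G : Euc k → Euc k →L[ℝ] Euc k →L[ℝ] ℝ) (y u v w : Euc k) : Euc k :=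
  fderiv ℝ (fun z => christoffel G z v w) y u - fderiv ℝ (fun z => christoffel G z u w) y v
    + christoffel G y u (christoffel G y v w) - christoffel G y v (christoffel G y u w)

/-- The Ricci tensor `Ric(v, w) = trace (u ↦ R(u, v) w)`. -/
def coordRicci (G : Euc k → Euc k →L[ℝ] Euc k →L[ℝ] ℝ) (y v w : Euc k) : ℝ :=
  ∑ i : Fin k, (riemannCurvature G y (EuclideanSpace.single i 1) v w) i

end Coordinates

/-! ### Riemannian manifolds and their isometric immersions in Euclidean space -/

section Manifolds

variable {k q : ℕ} {M : Type*} [TopologicalSpace M] [ChartedSpace (Euc k) M]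

/-- The components of a tangent vector at `p` in the preferred chart at `p`. -/
def chartVector (p : M) (v : TangentSpace (𝓡 k) p) : Euc k :=
  mfderiv (𝓡 k) 𝓘(ℝ, Euc k) (extChartAt (𝓡 k) p) p v

/-- The differential at `y` of the inverse of the preferred chart at `p`. -/
def chartSymmDeriv (p : M) (y : Euc k) : Euc k →L[ℝ] Euc k :=
  mfderiv 𝓘(ℝ, Euc k) (𝓡 k) (extChartAt (𝓡 k) p).symm y

/-- The differential `df(v) ∈ ℝ^q` of a map at `p`. -/
def differential (f : M → Euc q) (p : M) (v : TangentSpace (𝓡 k) p) : Euc q :=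
  mfderiv (𝓡 k) 𝓘(ℝ, Euc q) f p v

/-- A map read in the preferred chart at `p`. -/
def inChart (f : M → Euc q) (p : M) : Euc k → Euc q := fun y => f ((extChartAt (𝓡 k) p).symm y)

/-- The differential at `p`, as a linear map on chart components. -/
def chartDeriv (f : M → Euc q) (p : M) : Euc k →L[ℝ] Euc q :=
  fderiv ℝ (inChart f p) (extChartAt (𝓡 k) p p)

/-- The second derivative at `p` in the preferred chart, i.e. `∇̄_V W` for the flat connection `∇̄`
of `ℝ^q` and the coordinate fields `V, W` with values `v, w` at `p`. -/
def chartSecondDeriv (f : M → Euc q) (p : M) (v w : TangentSpace (𝓡 k) p) : Euc q :=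
  fderiv ℝ (fderiv ℝ (inChart f p)) (extChartAt (𝓡 k) p p) (chartVector p v) (chartVector p w)

/-- The tangent space `df(T_p M) ⊆ ℝ^q` of an immersed manifold. -/
def imageTangent (f : M → Euc q) (p : M) : Submodule ℝ (Euc q) :=
  LinearMap.range (chartDeriv (k := k) f p).toLinearMap

/-- The second fundamental form `B` of an immersed manifold in `ℝ^q`: the component of `∇̄_V W`
normal to `M`. -/
def secondFundamentalForm (f : M → Euc q) (p : M) (v w : TangentSpace (𝓡 k) p) : Euc q :=
  (imageTangent (k := k) f p)ᗮ.starProjection (chartSecondDeriv f p v w)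

/-- The second fundamental form of `M` in a submanifold of `ℝ^q` whose tangent space at `f p` is
`T`: the component of `∇̄_V W` tangent to the submanifold and normal to `M`. -/
def secondFundamentalFormIn (T : Submodule ℝ (Euc q)) (f : M → Euc q) (p : M)
    (v w : TangentSpace (𝓡 k) p) : Euc q :=
  (T ⊓ (imageTangent (k := k) f p)ᗮ).starProjection (chartSecondDeriv f p v w)

variable [IsManifold (𝓡 k) ∞ M]

/-- Smooth Riemannian metrics on a smooth `k`-manifold (without boundary). -/
abbrev RiemMetric (k : ℕ) (M : Type*) [TopologicalSpace M] [ChartedSpace (Euc k) M]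
    [IsManifold (𝓡 k) ∞ M] :=
  Bundle.ContMDiffRiemannianMetric (𝓡 k) ∞ (Euc k) (fun p : M => TangentSpace (𝓡 k) p)

/-- The scalar product of `T_p M`, on the underlying space `ℝᵏ` of `T_p M`. -/
def innerAt (g : RiemMetric k M) (p : M) : Euc k →L[ℝ] Euc k →L[ℝ] ℝ := g.inner p

/-- The metric in the preferred chart at `p`, i.e. its pullback by the inverse chart. -/
def coordMetric (g : RiemMetric k M) (p : M) (y : Euc k) : Euc k →L[ℝ] Euc k →L[ℝ] ℝ :=
  (innerAt g ((extChartAt (𝓡 k) p).symm y)).bilinearComp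
    (chartSymmDeriv p y) (chartSymmDeriv p y)

/-- The Ricci tensor `⟨Ric(v), w⟩` of the Riemannian manifold `(M, g)` at `p`. -/
def ricci (g : RiemMetric k M) (p : M) (v w : TangentSpace (𝓡 k) p) : ℝ :=
  coordRicci (coordMetric g p) (extChartAt (𝓡 k) p p) (chartVector p v) (chartVector p w)

/-- `e₁, …, e_k` is a `g`-orthonormal basis of `T_p M`. -/
def IsOrthonormalFrame (g : RiemMetric k M) (p : M) (e : Fin k → TangentSpace (𝓡 k) p) : Prop :=
  ∀ i j, g.inner p (e i) (e j) = if i = j then 1 else 0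

/-- `f` is a smooth map that preserves the Riemannian metric; it is then an immersion. -/
structure IsIsometricImmersion (g : RiemMetric k M) (f : M → Euc q) : Prop where
  smooth : ContMDiff (𝓡 k) 𝓘(ℝ, Euc q) ∞ f
  isometric : ∀ (p : M) (v w : TangentSpace (𝓡 k) p),
    ⟪differential f p v, differential f p w⟫_ℝ = g.inner p v w

/-- The functional `F_p(x) = ∑_β (4 ⟨B(x, e_β), B(x, e_β)⟩ - ⟨B(x, x), B(e_β, e_β)⟩)`. -/
def phiFunctional (f : M → Euc q) (p : M) (e : Fin k → TangentSpace (𝓡 k) p)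
    (x : TangentSpace (𝓡 k) p) : ℝ :=
  ∑ β : Fin k,
    (4 * ⟪secondFundamentalForm f p x (e β), secondFundamentalForm f p x (e β)⟫_ℝ
      - ⟪secondFundamentalForm f p x x, secondFundamentalForm f p (e β) (e β)⟫_ℝ)

/-- `(M, g)` is `Φ`-superstrongly unstable: for some isometric immersion in some `ℝ^q`, the
functional `F_p` is negative on all unit tangent vectors. -/
def IsPhiSSU (g : RiemMetric k M) : Prop :=
  ∃ (q : ℕ) (f : M → Euc q), IsIsometricImmersion g f ∧
    ∀ (p : M) (e : Fin k → TangentSpace (𝓡 k) p), IsOrthonormalFrame g p e →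
      ∀ x : TangentSpace (𝓡 k) p, g.inner p x x = 1 → phiFunctional f p e x < 0

end Manifolds

/-! ### Hypersurfaces of Euclidean space -/

section Hypersurfaces

variable {q : ℕ}

/-- Near `y ∈ S`, the set `S` is the regular zero set of the smooth function `h`. -/
structure IsLocalDefiningFunction (S : Set (Euc q)) (y : Euc q) (h : Euc q → ℝ) : Prop where
  smooth : ∀ᶠ z in 𝓝 y, ContDiffAt ℝ ∞ h z
  zero : h y = 0
  regular : fderiv ℝ h y ≠ 0
  mem_iff : ∀ᶠ z in 𝓝 y, z ∈ S ↔ h z = 0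

/-- `S` is a smooth embedded hypersurface of `ℝ^q`. -/
def IsHypersurface (S : Set (Euc q)) : Prop :=
  ∀ y ∈ S, ∃ h, IsLocalDefiningFunction S y h

/-- The tangent space at `y` of the hypersurface with local defining function `h`. -/
def hypersurfaceTangent (h : Euc q → ℝ) (y : Euc q) : Submodule ℝ (Euc q) :=
  LinearMap.ker (fderiv ℝ h y).toLinearMap

/-- `h` is a local defining function of the boundary of `C` that is nonpositive exactly on `C`. -/
structure IsOuterDefiningFunction (C : Set (Euc q)) (y : Euc q) (h : Euc q → ℝ) : Prop where
  defining : IsLocalDefiningFunction (frontier C) y h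
  mem_iff : ∀ᶠ z in 𝓝 y, z ∈ C ↔ h z ≤ 0

/-- `C` is a convex body with smooth boundary; `frontier C` is then a compact convex
hypersurface, and every compact convex hypersurface arises so. -/
structure IsSmoothConvexBody (C : Set (Euc q)) : Prop where
  convex : Convex ℝ C
  compact : IsCompact C
  interior_nonempty : (interior C).Nonempty
  smooth_boundary : ∀ y ∈ frontier C, ∃ h, IsOuterDefiningFunction C y h

/-- `c` is a principal curvature of `frontier C` at `y` with respect to the inner unit normal `ν`:
an eigenvalue of the Weingarten map `v ↦ -D_v ν` of the tangent space, where
`ν = -∇h / |∇h|` for an outer defining function `h`. -/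
def IsPrincipalCurvature (C : Set (Euc q)) (y : Euc q) (c : ℝ) : Prop :=
  ∃ h, IsOuterDefiningFunction C y h ∧ ∃ v ∈ hypersurfaceTangent h y, v ≠ 0 ∧
    fderiv ℝ (fun z => ‖gradient h z‖⁻¹ • gradient h z) y v = c • v

/-- `c` is the largest principal curvature of `frontier C` at `y`. -/
def IsMaxPrincipalCurvature (C : Set (Euc q)) (y : Euc q) (c : ℝ) : Prop :=
  IsGreatest {c : ℝ | IsPrincipalCurvature C y c} c

/-- The ellipsoid with semi-axes `a₁, …, a_q`. -/
def ellipsoid (a : Fin q → ℝ) : Set (Euc q) := {x | ∑ i, x i ^ 2 / a i ^ 2 = 1}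

/-- `f` exhibits `(M, g)` as an (immersed) minimal submanifold of the hypersurface `S`: it is an
isometric immersion with values in `S`, and the trace of the second fundamental form of `M` in `S`
vanishes. -/
structure IsMinimalSubmanifold {k : ℕ} {M : Type*} [TopologicalSpace M] [ChartedSpace (Euc k) M]
    [IsManifold (𝓡 k) ∞ M] (S : Set (Euc q)) (g : RiemMetric k M) (f : M → Euc q) : Prop where
  hypersurface : IsHypersurface S
  isometric : IsIsometricImmersion g f
  mem : ∀ p, f p ∈ S
  minimal : ∀ (p : M) (h : Euc q → ℝ), IsLocalDefiningFunction S (f p) h →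
    ∀ e : Fin k → TangentSpace (𝓡 k) p, IsOrthonormalFrame g p e →
      ∑ i, secondFundamentalFormIn (hypersurfaceTangent h (f p)) f p (e i) (e i) = 0

end Hypersurfaces

end

/-! The given immersion `f` itself witnesses instability. Write `B` for its second fundamental form
in `ℝ^q` and `H = ∑ B(e_i, e_i)`. The traced Gauss equation (`ricci_eq`) gives `∑ |B(x, e_i)|² =
⟨B(x, x), H⟩ - Ric(x, x)`, so `F(x) = -4 Ric(x, x) + 3 ⟨B(x, x), H⟩` (`phiFunctional_eq`).
Minimality in the hypersurface forces `H` to point along the hypersurface normal. Hence `⟨B(x, x),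
H⟩ = II(x, x) ∑ II(e_i, e_i)`, where `II` is the scalar second fundamental form of the hypersurface
(`inner_sum_secondFundamentalForm`). If `0 ≤ II ≤ c` on unit vectors, this product is at most `k
c²`, and `Ric > (3/4) k c²` makes `F` negative (`phiFunctional_neg`). It remains to bound `II`,
which is the tangential Hessian of a defining function `h` divided by `|∇h|`. For a convex body the
spectral theorem for the Weingarten map gives `c = λ_{q-1}` (`snd_bounds`). For an ellipsoid a
direct estimate of the Hessian and the gradient gives `c = max a / (min a)²`, and the sphere is the
ellipsoid with unit semi-axes. -/

noncomputable section

/-! ### The Gauss equation for a parametrized submanifold of `ℝ^q` -/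

section GaussEquation

variable {k q : ℕ}

/-- `G` is, near `y₀`, the metric induced by the smooth immersion `F`. -/
structure IsInducedMetricAt (F : Euc k → Euc q) (G : Euc k → Euc k →L[ℝ] Euc k →L[ℝ] ℝ)
    (y₀ : Euc k) : Prop where
  smooth : ∀ᶠ y in 𝓝 y₀, ContDiffAt ℝ ∞ F y
  injective : Function.Injective (fderiv ℝ F y₀)
  eq : ∀ᶠ y in 𝓝 y₀, ∀ v w, G y v w = ⟪fderiv ℝ F y v, fderiv ℝ F y w⟫_ℝ

/-- The inner product induced by a linear map into `ℝ^q`, as a composition of linear maps. -/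
def inducedInner (A : Euc k →L[ℝ] Euc q) : Euc k →L[ℝ] Euc k →L[ℝ] ℝ :=
  (((ContinuousLinearMap.compL ℝ (Euc k) (Euc q) ℝ).flip A).comp ((innerSL ℝ).comp A))

lemma inducedInner_apply (A : Euc k →L[ℝ] Euc q) (v w : Euc k) :
    inducedInner A v w = ⟪A v, A w⟫_ℝ := rfl

/-- Transfers smoothness from the differential of the immersion to the metric, seen as an
operator-valued map. -/
lemma contDiff_inducedInner : ContDiff ℝ ∞ (inducedInner (k := k) (q := q)) := by
  unfold inducedInner
  fun_prop

lemma isInvertible_of_apply_eq_zero {B : Euc k →L[ℝ] Euc k →L[ℝ] ℝ}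
    (hB : ∀ v, B v = 0 → v = 0) : B.IsInvertible := by
  have hi : Function.Injective B.toLinearMap :=
    (injective_iff_map_eq_zero B.toLinearMap).2 hB
  have hd : Module.finrank ℝ (Euc k) = Module.finrank ℝ (Euc k →L[ℝ] ℝ) := by
    rw [← (LinearMap.toContinuousLinearMap (𝕜 := ℝ) (E := Euc k) (F' := ℝ)).finrank_eq]
    exact (Subspace.dual_finrank_eq (K := ℝ) (V := Euc k)).symm
  let e := LinearMap.linearEquivOfInjective B.toLinearMap hi hd
  exact ⟨e.toContinuousLinearEquiv, by ext; rfl⟩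

namespace IsInducedMetricAt

variable {F : Euc k → Euc q} {G : Euc k → Euc k →L[ℝ] Euc k →L[ℝ] ℝ} {y₀ : Euc k}

lemma eventuallyEq (h : IsInducedMetricAt F G y₀) :
    G =ᶠ[𝓝 y₀] fun y => inducedInner (fderiv ℝ F y) := by
  filter_upwards [h.eq] with y hy
  ext v w
  rw [hy, inducedInner_apply]

lemma contDiffAt_fderiv (h : IsInducedMetricAt F G y₀) : ContDiffAt ℝ ∞ (fderiv ℝ F) y₀ :=
  h.smooth.self_of_nhds.fderiv_right (m := ∞) (by simp)

lemma contDiffAt (h : IsInducedMetricAt F G y₀) : ContDiffAt ℝ ∞ G y₀ :=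
  ContDiffAt.congr_of_eventuallyEq
    (contDiff_inducedInner.contDiffAt.comp y₀ h.contDiffAt_fderiv) h.eventuallyEq

lemma eq_self (h : IsInducedMetricAt F G y₀) (v w : Euc k) :
    G y₀ v w = ⟪fderiv ℝ F y₀ v, fderiv ℝ F y₀ w⟫_ℝ := h.eq.self_of_nhds v w

lemma eq_zero (h : IsInducedMetricAt F G y₀) {v : Euc k} (hv : G y₀ v v = 0) : v = 0 := by
  rw [h.eq_self, inner_self_eq_zero] at hv
  exact h.injective (by rw [hv, map_zero])

lemma isInvertible (h : IsInducedMetricAt F G y₀) : (G y₀).IsInvertible :=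
  isInvertible_of_apply_eq_zero fun v hv => h.eq_zero (by rw [hv]; rfl)

lemma eventually_isInvertible (h : IsInducedMetricAt F G y₀) :
    ∀ᶠ y in 𝓝 y₀, (G y).IsInvertible := by
  obtain ⟨e, he⟩ := h.isInvertible
  have := e.nhds
  rw [he] at this
  filter_upwards [h.contDiffAt.continuousAt this] with y hy
  exact hy

lemma fderiv_metric (h : IsInducedMetricAt F G y₀) (u v w : Euc k) :
    fderiv ℝ G y₀ u v w = ⟪fderiv ℝ (fderiv ℝ F) y₀ u v, fderiv ℝ F y₀ w⟫_ℝ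
      + ⟪fderiv ℝ F y₀ v, fderiv ℝ (fderiv ℝ F) y₀ u w⟫_ℝ := by
  have hG : HasFDerivAt G (fderiv ℝ G y₀) y₀ :=
    (h.contDiffAt.differentiableAt (by simp)).hasFDerivAt
  have hF : HasFDerivAt (fderiv ℝ F) (fderiv ℝ (fderiv ℝ F) y₀) y₀ :=
    (h.contDiffAt_fderiv.differentiableAt (by simp)).hasFDerivAt
  have h1 := (hG.clm_apply (hasFDerivAt_const v y₀)).clm_apply (hasFDerivAt_const w y₀)
  have h2 := (hF.clm_apply (hasFDerivAt_const v y₀)).inner ℝ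
    (hF.clm_apply (hasFDerivAt_const w y₀))
  have h3 := h1.unique (h2.congr_of_eventuallyEq (h.eq.mono fun y hy => hy v w))
  have h4 := congrArg (fun L => L u) h3
  simpa [add_comm] using h4

lemma symm_snd (h : IsInducedMetricAt F G y₀) (u v : Euc k) :
    fderiv ℝ (fderiv ℝ F) y₀ u v = fderiv ℝ (fderiv ℝ F) y₀ v u :=
  (h.smooth.self_of_nhds.isSymmSndFDerivAt (by simpa using ENat.LEInfty.out)) u v

/-- By the product rule the Koszul expression has six terms; symmetry of the second derivative
cancels four and doubles the rest. So `christoffel` represents the tangential part of the second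
derivative. -/
lemma metric_christoffel (h : IsInducedMetricAt F G y₀) (u v w : Euc k) :
    G y₀ (christoffel G y₀ u v) w
      = ⟪fderiv ℝ (fderiv ℝ F) y₀ u v, fderiv ℝ F y₀ w⟫_ℝ := by
  rw [christoffel, h.isInvertible.self_apply_inverse]
  simp only [_root_.smul_apply, _root_.add_apply,
    _root_.sub_apply, ContinuousLinearMap.flip_apply, h.fderiv_metric, smul_eq_mul]
  rw [h.symm_snd w u, h.symm_snd w v, h.symm_snd v u,
    real_inner_comm (fderiv ℝ F y₀ v) (fderiv ℝ (fderiv ℝ F) y₀ u w)]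
  ring

/-- Invertibility of the metric is an open condition, so pointwise identities such as
`metric_christoffel` hold on a neighbourhood and can be differentiated. -/
lemma eventually_self (h : IsInducedMetricAt F G y₀) :
    ∀ᶠ y in 𝓝 y₀, IsInducedMetricAt F G y := by
  filter_upwards [h.smooth.eventually_nhds, h.eventually_isInvertible, h.eq.eventually_nhds] with y hy hi he
  refine ⟨hy, (injective_iff_map_eq_zero _).2 fun v hv => ?_, he⟩
  have h0 : G y v = G y 0 := by
    ext w
    rw [he.self_of_nhds, he.self_of_nhds, hv, map_zero]
  have := congrArg (G y).inverse h0
  rwa [hi.inverse_apply_self, hi.inverse_apply_self] at this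

lemma christoffel_eq (h : IsInducedMetricAt F G y₀) (u v : Euc k) :
    christoffel G y₀ u v = (G y₀).inverse
      ((innerSL ℝ (fderiv ℝ (fderiv ℝ F) y₀ u v)).comp (fderiv ℝ F y₀)) := by
  rw [eq_comm, h.isInvertible.inverse_apply_eq]
  ext w
  rw [h.metric_christoffel]
  rfl

/-- Needed so that the `fderiv` terms in `riemannCurvature` are genuine derivatives and not the
default value zero. -/
lemma differentiableAt_christoffel (h : IsInducedMetricAt F G y₀) (u v : Euc k) :
    DifferentiableAt ℝ (fun y => christoffel G y u v) y₀ := by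
  have hG : DifferentiableAt ℝ G y₀ := h.contDiffAt.differentiableAt (by simp)
  have hF : DifferentiableAt ℝ (fderiv ℝ F) y₀ := h.contDiffAt_fderiv.differentiableAt (by simp)
  have hF2 : DifferentiableAt ℝ (fderiv ℝ (fderiv ℝ F)) y₀ :=
    (h.contDiffAt_fderiv.fderiv_right (m := ∞) (by simp)).differentiableAt (by simp)
  have hi : DifferentiableAt ℝ (fun y => (G y).inverse) y₀ :=
    (h.isInvertible.contDiffAt_map_inverse (n := 1)).differentiableAt (by simp) |>.comp y₀ hG
  refine DifferentiableAt.congr_of_eventuallyEq (hi.clm_apply (u := fun y =>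
    (innerSL ℝ (fderiv ℝ (fderiv ℝ F) y u v)).comp (fderiv ℝ F y)) ?_)
    (h.eventually_self.mono fun y hy => hy.christoffel_eq u v)
  refine DifferentiableAt.clm_comp ?_ hF
  exact (innerSL ℝ (E := Euc q)).differentiableAt.comp y₀
    ((hF2.clm_apply (differentiableAt_const u)).clm_apply (differentiableAt_const v))

lemma hasDeriv_metric_christoffel (h : IsInducedMetricAt F G y₀) (u v w z : Euc k) :
    fderiv ℝ G y₀ u (christoffel G y₀ v w) z
        + G y₀ (fderiv ℝ (fun y => christoffel G y v w) y₀ u) z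
      = ⟪fderiv ℝ (fderiv ℝ (fderiv ℝ F)) y₀ u v w, fderiv ℝ F y₀ z⟫_ℝ
        + ⟪fderiv ℝ (fderiv ℝ F) y₀ v w, fderiv ℝ (fderiv ℝ F) y₀ u z⟫_ℝ := by
  have hG : HasFDerivAt G (fderiv ℝ G y₀) y₀ :=
    (h.contDiffAt.differentiableAt (by simp)).hasFDerivAt
  have hF : HasFDerivAt (fderiv ℝ F) (fderiv ℝ (fderiv ℝ F) y₀) y₀ :=
    (h.contDiffAt_fderiv.differentiableAt (by simp)).hasFDerivAt
  have hF2 : HasFDerivAt (fderiv ℝ (fderiv ℝ F)) (fderiv ℝ (fderiv ℝ (fderiv ℝ F)) y₀) y₀ :=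
    ((h.contDiffAt_fderiv.fderiv_right (m := ∞) (by simp)).differentiableAt
      (by simp)).hasFDerivAt
  have hΓ := (h.differentiableAt_christoffel v w).hasFDerivAt
  have h1 := (hG.clm_apply hΓ).clm_apply (hasFDerivAt_const z y₀)
  have h2 := ((hF2.clm_apply (hasFDerivAt_const v y₀)).clm_apply (hasFDerivAt_const w y₀)).inner ℝ
    (hF.clm_apply (hasFDerivAt_const z y₀))
  have h3 := h1.unique (h2.congr_of_eventuallyEq
    (h.eventually_self.mono fun y hy => hy.metric_christoffel v w z))
  have h4 := congrArg (fun L => L u) h3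
  simp only [_root_.add_apply, ContinuousLinearMap.comp_apply, ContinuousLinearMap.flip_apply,
    _root_.zero_apply, map_zero, zero_add,
    fderivInnerCLM_apply] at h4
  rw [add_comm, h4, add_comm]
  simp only [ContinuousLinearMap.prod_apply, ContinuousLinearMap.comp_zero,
    ContinuousLinearMap.flip_apply, zero_add]

/-- The component of the second derivative normal to the submanifold. -/
lemma starProjection_snd (h : IsInducedMetricAt F G y₀) (u v : Euc k) :
    (LinearMap.range (fderiv ℝ F y₀).toLinearMap)ᗮ.starProjection (fderiv ℝ (fderiv ℝ F) y₀ u v)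
      = fderiv ℝ (fderiv ℝ F) y₀ u v - fderiv ℝ F y₀ (christoffel G y₀ u v) := by
  have hz : fderiv ℝ F y₀ (christoffel G y₀ u v) ∈
      LinearMap.range (fderiv ℝ F y₀).toLinearMap := ⟨_, rfl⟩
  refine Submodule.eq_starProjection_of_mem_orthogonal' (z := fderiv ℝ F y₀ (christoffel G y₀ u v))
    ?_ (Submodule.le_orthogonal_orthogonal _ hz) (sub_add_cancel _ _).symm
  rw [Submodule.mem_orthogonal']
  rintro _ ⟨w, rfl⟩
  rw [inner_sub_left, ContinuousLinearMap.coe_coe, ← h.metric_christoffel, h.eq_self, sub_self]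

/-- The Gauss equation. -/
lemma metric_riemannCurvature (h : IsInducedMetricAt F G y₀) (u v w z : Euc k)
    {B : Euc k → Euc k → Euc q}
    (hB : ∀ u v, B u v = (LinearMap.range (fderiv ℝ F y₀).toLinearMap)ᗮ.starProjection
      (fderiv ℝ (fderiv ℝ F) y₀ u v)) :
    G y₀ (riemannCurvature G y₀ u v w) z = ⟪B v w, B u z⟫_ℝ - ⟪B u w, B v z⟫_ℝ := by
  have hperp : ∀ a b c : Euc k, ⟪B a b, fderiv ℝ F y₀ c⟫_ℝ = 0 := fun a b c => by
    rw [hB]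
    exact (Submodule.mem_orthogonal' _ _).1 (Submodule.starProjection_apply_mem _ _) _ ⟨c, rfl⟩
  -- Split second derivatives into normal part `B` and tangential part in the differentiated
  -- identity: the purely tangential terms cancel. The remaining third derivative is symmetric in
  -- `a, b`, so it disappears from the curvature by antisymmetrization.
  have key : ∀ a b c : Euc k,
      G y₀ (fderiv ℝ (fun y => christoffel G y b c) y₀ a) z
        + G y₀ (christoffel G y₀ a (christoffel G y₀ b c)) z
      = ⟪fderiv ℝ (fderiv ℝ (fderiv ℝ F)) y₀ a b c, fderiv ℝ F y₀ z⟫_ℝ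
        + ⟪B b c, B a z⟫_ℝ := by
    intro a b c
    have h1 := h.hasDeriv_metric_christoffel a b c z
    rw [h.fderiv_metric, ← h.metric_christoffel] at h1
    have h2 : ∀ a b, fderiv ℝ (fderiv ℝ F) y₀ a b
        = B a b + fderiv ℝ F y₀ (christoffel G y₀ a b) := fun a b => by
      rw [hB, h.starProjection_snd, sub_add_cancel]
    have h3 : ⟪fderiv ℝ (fderiv ℝ F) y₀ b c, fderiv ℝ (fderiv ℝ F) y₀ a z⟫_ℝ
        = ⟪B b c, B a z⟫_ℝ
          + ⟪fderiv ℝ F y₀ (christoffel G y₀ b c), fderiv ℝ (fderiv ℝ F) y₀ a z⟫_ℝ := by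
      nth_rewrite 1 [h2 b c]
      rw [inner_add_left]
      nth_rewrite 1 [h2 a z]
      rw [inner_add_right, hperp, add_zero]
    rw [h3] at h1
    linarith
  have hsymm : fderiv ℝ (fderiv ℝ (fderiv ℝ F)) y₀ u v = fderiv ℝ (fderiv ℝ (fderiv ℝ F)) y₀ v u :=
    (h.contDiffAt_fderiv.isSymmSndFDerivAt (by simpa using ENat.LEInfty.out)) u v
  have k1 := key u v w
  have k2 := key v u w
  rw [hsymm] at k1
  simp only [riemannCurvature, map_add, map_sub, _root_.add_apply,
    _root_.sub_apply]
  linarith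

/-- The Ricci tensor is computed by any orthonormal frame. -/
lemma coordRicci_eq (h : IsInducedMetricAt F G y₀) (v w : Euc k)
    {B : Euc k → Euc k → Euc q}
    (hB : ∀ u v, B u v = (LinearMap.range (fderiv ℝ F y₀).toLinearMap)ᗮ.starProjection
      (fderiv ℝ (fderiv ℝ F) y₀ u v))
    {e : Fin k → Euc k} (he : ∀ i j, G y₀ (e i) (e j) = if i = j then 1 else 0) :
    coordRicci G y₀ v w
      = ∑ i, (⟪B v w, B (e i) (e i)⟫_ℝ - ⟪B (e i) w, B v (e i)⟫_ℝ) := by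
  have hnd : ∀ a b : Euc k, (∀ z, G y₀ a z = G y₀ b z) → a = b := fun a b hab =>
    sub_eq_zero.1 (h.eq_zero (by simp [hab]))
  have hB1 : ∀ a b c, B (a + b) c = B a c + B b c := fun a b c => by
    rw [hB, hB, hB, map_add, _root_.add_apply, map_add]
  have hB2 : ∀ (r : ℝ) a c, B (r • a) c = r • B a c := fun r a c => by
    rw [hB, hB, map_smul, _root_.smul_apply, map_smul]
  -- Linearity is read off the Gauss equation through nondegeneracy of the metric. The trace can
  -- then be moved from the standard basis to the orthonormal frame.
  let L : Euc k →ₗ[ℝ] Euc k :=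
    { toFun := fun u => riemannCurvature G y₀ u v w
      map_add' := fun a b => hnd _ _ fun z => by
        rw [map_add, _root_.add_apply]
        simp only [h.metric_riemannCurvature _ _ _ _ hB, hB1, inner_add_left, inner_add_right]
        ring
      map_smul' := fun r a => hnd _ _ fun z => by
        rw [map_smul, _root_.smul_apply]
        simp only [h.metric_riemannCurvature _ _ _ _ hB, hB2, real_inner_smul_left,
          real_inner_smul_right, RingHom.id_apply, smul_eq_mul]
        ring }
  have hli : LinearIndependent ℝ e := by
    rw [Fintype.linearIndependent_iff]
    intro c hc i
    have := congrArg (fun x => G y₀ x (e i)) hc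
    simpa [he] using this
  have hspan : ⊤ ≤ Submodule.span ℝ (Set.range e) :=
    (hli.span_eq_top_of_card_eq_finrank' (by simp)).ge
  let b : Module.Basis (Fin k) ℝ (Euc k) := Module.Basis.mk hli hspan
  have hbe : ∀ i, b i = e i := fun i => by simp [b]
  have hrepr : ∀ x i, b.repr x i = G y₀ x (e i) := fun x i => by
    conv_rhs => rw [← b.sum_repr x]
    simp [hbe, he]
  have t1 : coordRicci G y₀ v w = LinearMap.trace ℝ _ L := by
    rw [LinearMap.trace_eq_matrix_trace ℝ (EuclideanSpace.basisFun (Fin k) ℝ).toBasis]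
    simp [coordRicci, Matrix.trace, LinearMap.toMatrix_apply, L]
  have t2 : LinearMap.trace ℝ _ L = ∑ i, G y₀ (L (e i)) (e i) := by
    rw [LinearMap.trace_eq_matrix_trace ℝ b]
    simp [Matrix.trace, LinearMap.toMatrix_apply, hrepr, hbe]
  rw [t1, t2]
  exact Finset.sum_congr rfl fun i _ => h.metric_riemannCurvature _ _ _ _ hB

end IsInducedMetricAt

end GaussEquation

end

noncomputable section

/-! ### The Gauss equation for isometrically immersed manifolds -/

section Immersions

variable {k q : ℕ} {M : Type*} [TopologicalSpace M] [ChartedSpace (Euc k) M]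
  [IsManifold (𝓡 k) ∞ M]

lemma exists_chartVector_eq (p : M) (a : Euc k) :
    ∃ v : TangentSpace (𝓡 k) p, chartVector p v = a := by
  obtain ⟨e, he⟩ := isInvertible_mfderiv_extChartAt (I := 𝓡 k) (mem_extChartAt_source p)
  refine ⟨e.symm a, ?_⟩
  unfold chartVector
  rw [← he]
  exact e.apply_symm_apply a

namespace IsIsometricImmersion

variable {g : RiemMetric k M} {f : M → Euc q}

lemma contDiffAt_inChart (hf : IsIsometricImmersion g f) (p : M) {y : Euc k}
    (hy : y ∈ (extChartAt (𝓡 k) p).target) : ContDiffAt ℝ ∞ (inChart f p) y := by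
  have h1 : ContMDiffAt 𝓘(ℝ, Euc k) (𝓡 k) ∞ (extChartAt (𝓡 k) p).symm y :=
    (contMDiffOn_extChartAt_symm p).contMDiffAt ((isOpen_extChartAt_target p).mem_nhds hy)
  exact (hf.smooth.contMDiffAt.comp y h1).contDiffAt

lemma fderiv_inChart (hf : IsIsometricImmersion g f) (p : M) {y : Euc k}
    (hy : y ∈ (extChartAt (𝓡 k) p).target) (v : Euc k) :
    fderiv ℝ (inChart f p) y v
      = differential f ((extChartAt (𝓡 k) p).symm y) (chartSymmDeriv p y v) := by
  have h1 : ContMDiffAt 𝓘(ℝ, Euc k) (𝓡 k) ∞ (extChartAt (𝓡 k) p).symm y :=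
    (contMDiffOn_extChartAt_symm p).contMDiffAt ((isOpen_extChartAt_target p).mem_nhds hy)
  have h2 := mfderiv_comp y (hf.smooth.contMDiffAt.mdifferentiableAt (by simp))
    (h1.mdifferentiableAt (by simp))
  rw [← mfderiv_eq_fderiv]
  exact congrArg (fun L => L v) h2

lemma differential_eq (hf : IsIsometricImmersion g f) (p : M) (v : TangentSpace (𝓡 k) p) :
    differential f p v
      = fderiv ℝ (inChart f p) (extChartAt (𝓡 k) p p) (chartVector p v) := by
  have h1 : MDifferentiableAt 𝓘(ℝ, Euc k) 𝓘(ℝ, Euc q) (inChart f p) (extChartAt (𝓡 k) p p) :=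
    ((hf.contDiffAt_inChart p (mem_extChartAt_target p)).differentiableAt
      (by simp)).mdifferentiableAt
  have h2 : MDifferentiableAt (𝓡 k) 𝓘(ℝ, Euc k) (extChartAt (𝓡 k) p) p :=
    mdifferentiableAt_extChartAt (mem_chart_source _ p)
  have h3 : f =ᶠ[𝓝 p] inChart f p ∘ extChartAt (𝓡 k) p := by
    filter_upwards [extChartAt_source_mem_nhds (I := 𝓡 k) p] with z hz
    simp only [inChart, Function.comp_apply, PartialEquiv.left_inv _ hz]
  have h4 := h3.mfderiv_eq (I := 𝓡 k) (I' := 𝓘(ℝ, Euc q))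
  rw [mfderiv_comp p h1 h2, mfderiv_eq_fderiv] at h4
  exact congrArg (fun L => L v) h4

lemma isInducedMetricAt (hf : IsIsometricImmersion g f) (p : M) :
    IsInducedMetricAt (inChart f p) (coordMetric g p) (extChartAt (𝓡 k) p p) where
  smooth := by
    filter_upwards [extChartAt_target_mem_nhds (I := 𝓡 k) p] with y hy
    exact hf.contDiffAt_inChart p hy
  injective := by
    refine (injective_iff_map_eq_zero _).2 fun a ha => ?_
    obtain ⟨v, rfl⟩ := exists_chartVector_eq p a
    rw [← hf.differential_eq] at ha
    by_cases hv : v = 0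
    · rw [hv]
      exact map_zero (mfderiv (𝓡 k) 𝓘(ℝ, Euc k) (extChartAt (𝓡 k) p) p)
    · have h1 := g.pos p v hv
      rw [← hf.isometric, ha, inner_self_eq_zero.2 rfl] at h1
      exact absurd h1 (lt_irrefl _)
  eq := by
    filter_upwards [extChartAt_target_mem_nhds (I := 𝓡 k) p] with y hy v w
    rw [hf.fderiv_inChart p hy, hf.fderiv_inChart p hy]
    exact (hf.isometric _ _ _).symm

lemma coordMetric_chartVector (hf : IsIsometricImmersion g f) (p : M)
    (v w : TangentSpace (𝓡 k) p) :
    coordMetric g p (extChartAt (𝓡 k) p p) (chartVector p v) (chartVector p w)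
      = g.inner p v w := by
  rw [(hf.isInducedMetricAt p).eq_self, ← hf.differential_eq, ← hf.differential_eq, hf.isometric]

lemma ricci_eq (hf : IsIsometricImmersion g f) {p : M} {e : Fin k → TangentSpace (𝓡 k) p}
    (he : IsOrthonormalFrame g p e) (x : TangentSpace (𝓡 k) p) :
    ricci g p x x
      = ∑ i, (⟪secondFundamentalForm f p x x, secondFundamentalForm f p (e i) (e i)⟫_ℝ
        - ⟪secondFundamentalForm f p x (e i), secondFundamentalForm f p x (e i)⟫_ℝ) := by
  have h := hf.isInducedMetricAt p
  have hR := h.coordRicci_eq (chartVector p x) (chartVector p x) (fun _ _ => rfl)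
    (e := fun i => chartVector p (e i))
    (fun i j => by rw [hf.coordMetric_chartVector, he])
  rw [ricci, hR]
  refine Finset.sum_congr rfl fun i _ => ?_
  rw [h.symm_snd (chartVector p (e i)) (chartVector p x)]
  rfl

lemma phiFunctional_eq (hf : IsIsometricImmersion g f) {p : M}
    {e : Fin k → TangentSpace (𝓡 k) p} (he : IsOrthonormalFrame g p e)
    (x : TangentSpace (𝓡 k) p) :
    phiFunctional f p e x = -4 * ricci g p x x
      + 3 * ⟪secondFundamentalForm f p x x, ∑ i, secondFundamentalForm f p (e i) (e i)⟫_ℝ := by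
  rw [hf.ricci_eq he, phiFunctional, inner_sum, Finset.mul_sum, Finset.mul_sum,
    ← Finset.sum_add_distrib]
  exact Finset.sum_congr rfl fun i _ => by ring

/-! ### Submanifolds of a hypersurface -/

variable {S : Set (Euc q)} {h : Euc q → ℝ} {p : M}

omit [IsManifold (𝓡 k) ∞ M] in
lemma inChart_self (f : M → Euc q) (p : M) : inChart f p (extChartAt (𝓡 k) p p) = f p := by
  simp [inChart]

lemma eventually_comp_inChart (hf : IsIsometricImmersion g f) (hS : ∀ p, f p ∈ S)
    (hh : IsLocalDefiningFunction S (f p) h) :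
    ∀ᶠ y in 𝓝 (extChartAt (𝓡 k) p p), h (inChart f p y) = 0 := by
  have hc : ContinuousAt (inChart f p) (extChartAt (𝓡 k) p p) :=
    (hf.contDiffAt_inChart p (mem_extChartAt_target p)).continuousAt
  have h1 := hh.mem_iff
  rw [← inChart_self (k := k) f p] at h1
  filter_upwards [hc.eventually h1] with y hy
  exact hy.1 (hS _)

lemma eventually_fderiv_comp_inChart (hf : IsIsometricImmersion g f) (hS : ∀ p, f p ∈ S)
    (hh : IsLocalDefiningFunction S (f p) h) :
    ∀ᶠ y in 𝓝 (extChartAt (𝓡 k) p p), ∀ v,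
      fderiv ℝ h (inChart f p y) (fderiv ℝ (inChart f p) y v) = 0 := by
  have hc : ContinuousAt (inChart f p) (extChartAt (𝓡 k) p p) :=
    (hf.contDiffAt_inChart p (mem_extChartAt_target p)).continuousAt
  have h1 := hh.smooth
  rw [← inChart_self (k := k) f p] at h1
  filter_upwards [hc.eventually h1, (hf.eventually_comp_inChart hS hh).eventually_nhds,
    extChartAt_target_mem_nhds (I := 𝓡 k) p] with y hy h0 hyt v
  have hd := (hy.differentiableAt (by simp)).hasFDerivAt.comp y
    ((hf.contDiffAt_inChart p hyt).differentiableAt (by simp)).hasFDerivAt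
  have h2 := hd.unique ((hasFDerivAt_const (0 : ℝ) y).congr_of_eventuallyEq h0)
  exact congrArg (fun L => L v) h2

lemma fderiv_differential (hf : IsIsometricImmersion g f) (hS : ∀ p, f p ∈ S)
    (hh : IsLocalDefiningFunction S (f p) h) (v : TangentSpace (𝓡 k) p) :
    fderiv ℝ h (f p) (differential f p v) = 0 := by
  have h1 := (hf.eventually_fderiv_comp_inChart hS hh).self_of_nhds (chartVector p v)
  rwa [inChart_self, ← hf.differential_eq] at h1

/-- Differentiate `h ∘ F = 0` twice, `F` being `f` in the chart: `h''(F'v, F'w) + h'(F''(v, w)) =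
0`. -/
lemma fderiv_chartSecondDeriv (hf : IsIsometricImmersion g f) (hS : ∀ p, f p ∈ S)
    (hh : IsLocalDefiningFunction S (f p) h) (v w : TangentSpace (𝓡 k) p) :
    fderiv ℝ h (f p) (chartSecondDeriv f p v w)
      = -fderiv ℝ (fderiv ℝ h) (f p) (differential f p v) (differential f p w) := by
  have hF := (hf.contDiffAt_inChart p (mem_extChartAt_target p))
  have hF1 := (hF.differentiableAt (by simp)).hasFDerivAt
  have hF2 := ((hF.fderiv_right (m := ∞) (by simp)).differentiableAt (by simp)).hasFDerivAt
  have h1 := ((hh.smooth.self_of_nhds.fderiv_right (m := ∞) (by simp)).differentiableAt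
    (by simp)).hasFDerivAt
  rw [← inChart_self (k := k) f p] at h1
  have h2 := (h1.comp _ hF1).clm_apply
    (hF2.clm_apply (hasFDerivAt_const (chartVector p w) (extChartAt (𝓡 k) p p)))
  have h3 := h2.unique ((hasFDerivAt_const (0 : ℝ) _).congr_of_eventuallyEq
    ((hf.eventually_fderiv_comp_inChart hS hh).mono fun y hy => hy _))
  have h4 := congrArg (fun L => L (chartVector p v)) h3
  simp only [_root_.add_apply, ContinuousLinearMap.comp_apply, ContinuousLinearMap.flip_apply,
    _root_.zero_apply, map_zero, zero_add, Function.comp_apply, inChart_self,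
    ← hf.differential_eq] at h4
  exact eq_neg_of_add_eq_zero_left h4

end IsIsometricImmersion

lemma inner_gradient (h : Euc q → ℝ) (y v : Euc q) : ⟪gradient h y, v⟫_ℝ = fderiv ℝ h y v := by
  rw [gradient, InnerProductSpace.toDual_symm_apply]

lemma norm_gradient (h : Euc q → ℝ) (y : Euc q) : ‖gradient h y‖ = ‖fderiv ℝ h y‖ := by
  rw [gradient, LinearIsometryEquiv.norm_map]

/-! ### Minimal submanifolds of a hypersurface and the sign of `F` -/

section Criterion

variable {S : Set (Euc q)} {g : RiemMetric k M} {f : M → Euc q} {h : Euc q → ℝ} {p : M}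

lemma differential_mem_imageTangent (hf : IsIsometricImmersion g f)
    {a : Euc q} (ha : a ∈ imageTangent (k := k) f p) :
    ∃ v : TangentSpace (𝓡 k) p, differential f p v = a := by
  obtain ⟨b, rfl⟩ := ha
  obtain ⟨v, rfl⟩ := exists_chartVector_eq p b
  exact ⟨v, hf.differential_eq p v⟩

lemma gradient_mem_orthogonal (hf : IsIsometricImmersion g f) (hS : ∀ p, f p ∈ S)
    (hh : IsLocalDefiningFunction S (f p) h) :
    gradient h (f p) ∈ (imageTangent (k := k) f p)ᗮ := by
  rw [Submodule.mem_orthogonal']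
  intro a ha
  obtain ⟨v, rfl⟩ := differential_mem_imageTangent hf ha
  rw [inner_gradient, hf.fderiv_differential hS hh]

/-- The component of the second fundamental form along the normal of the hypersurface. -/
lemma inner_secondFundamentalForm_gradient (hf : IsIsometricImmersion g f) (hS : ∀ p, f p ∈ S)
    (hh : IsLocalDefiningFunction S (f p) h) (v w : TangentSpace (𝓡 k) p) :
    ⟪secondFundamentalForm f p v w, gradient h (f p)⟫_ℝ
      = -fderiv ℝ (fderiv ℝ h) (f p) (differential f p v) (differential f p w) := by
  rw [secondFundamentalForm, Submodule.inner_starProjection_left_eq_right,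
    Submodule.starProjection_eq_self_iff.2 (gradient_mem_orthogonal hf hS hh), real_inner_comm,
    inner_gradient, hf.fderiv_chartSecondDeriv hS hh]

/-- The mean curvature vector of a minimal submanifold of a hypersurface is normal to the
hypersurface. -/
lemma inner_sum_secondFundamentalForm (hM : IsMinimalSubmanifold S g f)
    (hh : IsLocalDefiningFunction S (f p) h) {e : Fin k → TangentSpace (𝓡 k) p}
    (he : IsOrthonormalFrame g p e) {w : Euc q} (hw : w ∈ (imageTangent (k := k) f p)ᗮ) :
    ⟪w, ∑ i, secondFundamentalForm f p (e i) (e i)⟫_ℝ * ‖gradient h (f p)‖ ^ 2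
      = ⟪w, gradient h (f p)⟫_ℝ
        * ⟪∑ i, secondFundamentalForm f p (e i) (e i), gradient h (f p)⟫_ℝ := by
  set N := gradient h (f p) with hN
  have hNo := gradient_mem_orthogonal hM.isometric hM.mem hh
  -- The part of `w` orthogonal to `N`, scaled by `‖N‖²` to avoid division. It lies in the range of
  -- both projections, which are self-adjoint, so pairing with it turns the vanishing trace in the
  -- hypersurface into `⟪w', H⟫ = 0`.
  set w' : Euc q := ‖N‖ ^ 2 • w - ⟪w, N⟫_ℝ • N with hw'
  have hw'T : w' ∈ hypersurfaceTangent h (f p) ⊓ (imageTangent (k := k) f p)ᗮ := by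
    refine ⟨?_, Submodule.sub_mem _ (Submodule.smul_mem _ _ hw) (Submodule.smul_mem _ _ hNo)⟩
    change fderiv ℝ h (f p) w' = 0
    rw [← inner_gradient, ← hN, hw', inner_sub_right, real_inner_smul_right,
      real_inner_smul_right, real_inner_self_eq_norm_sq, real_inner_comm]
    ring
  have h0 : ⟪w', ∑ i, secondFundamentalForm f p (e i) (e i)⟫_ℝ = 0 := by
    have h1 := hM.minimal p h hh e he
    have h2 := congrArg (fun z => ⟪w', z⟫_ℝ) h1
    simp only [inner_zero_right, inner_sum] at h2
    rw [inner_sum, ← h2]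
    refine Finset.sum_congr rfl fun i _ => ?_
    rw [secondFundamentalForm, secondFundamentalFormIn,
      ← Submodule.inner_starProjection_left_eq_right, ← Submodule.inner_starProjection_left_eq_right,
      Submodule.starProjection_eq_self_iff.2 hw'T, Submodule.starProjection_eq_self_iff.2 hw'T.2]
  rw [hw', inner_sub_left, real_inner_smul_left, real_inner_smul_left, real_inner_comm _ N] at h0
  linarith

/-- A lower bound of the Ricci curvature in terms of an upper bound `c` for the second fundamental
form of a convex hypersurface makes the functional `F_p` negative. -/
lemma phiFunctional_neg (hM : IsMinimalSubmanifold S g f)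
    (hh : IsLocalDefiningFunction S (f p) h) {c : ℝ}
    (h0 : ∀ v ∈ hypersurfaceTangent h (f p), 0 ≤ fderiv ℝ (fderiv ℝ h) (f p) v v)
    (hc : ∀ v ∈ hypersurfaceTangent h (f p),
      fderiv ℝ (fderiv ℝ h) (f p) v v ≤ c * ‖fderiv ℝ h (f p)‖ * ‖v‖ ^ 2)
    {e : Fin k → TangentSpace (𝓡 k) p} (he : IsOrthonormalFrame g p e)
    {x : TangentSpace (𝓡 k) p} (hx : g.inner p x x = 1)
    (hR : 3 / 4 * (k : ℝ) * c ^ 2 < ricci g p x x) :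
    phiFunctional f p e x < 0 := by
  have hf := hM.isometric
  have hB := inner_sum_secondFundamentalForm hM hh he
    (w := secondFundamentalForm f p x x) (Submodule.starProjection_apply_mem _ _)
  have hNpos : 0 < ‖fderiv ℝ h (f p)‖ := norm_pos_iff.2 hh.regular
  have hunit : ∀ v : TangentSpace (𝓡 k) p, g.inner p v v = 1 →
      0 ≤ fderiv ℝ (fderiv ℝ h) (f p) (differential f p v) (differential f p v) ∧
      fderiv ℝ (fderiv ℝ h) (f p) (differential f p v) (differential f p v)
        ≤ c * ‖fderiv ℝ h (f p)‖ := by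
    intro v hv
    have hT : differential f p v ∈ hypersurfaceTangent h (f p) :=
      hf.fderiv_differential hM.mem hh v
    refine ⟨h0 _ hT, (hc _ hT).trans_eq ?_⟩
    rw [← real_inner_self_eq_norm_sq, hf.isometric, hv, mul_one]
  rw [sum_inner, norm_gradient] at hB
  simp only [inner_secondFundamentalForm_gradient hf hM.mem hh, Finset.sum_neg_distrib,
    neg_mul_neg] at hB
  have hx' := hunit x hx
  have hs0 := Finset.sum_nonneg fun i (_ : i ∈ Finset.univ) =>
    (hunit (e i) (by rw [he, if_pos rfl])).1
  have hs1 := Finset.sum_le_sum fun i (_ : i ∈ Finset.univ) =>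
    (hunit (e i) (by rw [he, if_pos rfl])).2
  rw [Finset.sum_const, Finset.card_univ, Fintype.card_fin, nsmul_eq_mul] at hs1
  -- Convexity enters here: upper bounds multiply only because the Hessian is nonnegative on tangent
  -- vectors. Each factor carries one `‖fderiv ℝ h (f p)‖`, matching the square in `hB`.
  have hle := mul_le_mul hx'.2 hs1 hs0 (hx'.1.trans hx'.2)
  rw [← hB] at hle
  have hle' : ⟪secondFundamentalForm f p x x, ∑ i, secondFundamentalForm f p (e i) (e i)⟫_ℝ
      ≤ k * c ^ 2 := by
    refine le_of_mul_le_mul_right (hle.trans_eq ?_) (pow_pos hNpos 2)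
    ring
  rw [hf.phiFunctional_eq he]
  linarith

end Criterion

end Immersions

/-! ### Principal curvatures -/

section PrincipalCurvatures

variable {q : ℕ} {S : Set (Euc q)} {h : Euc q → ℝ} {y : Euc q}

namespace IsLocalDefiningFunction

lemma fderiv_smooth (hh : IsLocalDefiningFunction S y h) : ContDiffAt ℝ ∞ (fderiv ℝ h) y :=
  hh.smooth.self_of_nhds.fderiv_right (m := ∞) (by simp)

lemma differentiableAt_gradient (hh : IsLocalDefiningFunction S y h) :
    DifferentiableAt ℝ (gradient h) y := by
  rw [differentiableAt_euclidean]
  intro i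
  have h1 : (fun z => gradient h z i) = fun z => fderiv ℝ h z (EuclideanSpace.single i 1) := by
    ext z
    rw [← inner_gradient, EuclideanSpace.inner_single_right]
    simp
  rw [h1]
  exact (hh.fderiv_smooth.differentiableAt (by simp)).clm_apply (differentiableAt_const _)

lemma inner_fderiv_gradient (hh : IsLocalDefiningFunction S y h) (v u : Euc q) :
    ⟪fderiv ℝ (gradient h) y v, u⟫_ℝ = fderiv ℝ (fderiv ℝ h) y v u := by
  have h1 := hh.differentiableAt_gradient.hasFDerivAt.inner ℝ (hasFDerivAt_const u y)
  have h2 := (hh.fderiv_smooth.differentiableAt (by simp)).hasFDerivAt.clm_apply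
    (hasFDerivAt_const u y)
  simp_rw [inner_gradient] at h1
  simpa using congrArg (fun L => L v) (h1.unique h2)

lemma gradient_ne_zero (hh : IsLocalDefiningFunction S y h) : gradient h y ≠ 0 := by
  rw [← norm_pos_iff, norm_gradient, norm_pos_iff]
  exact hh.regular

lemma differentiableAt_normal (hh : IsLocalDefiningFunction S y h) :
    DifferentiableAt ℝ (fun z => ‖gradient h z‖⁻¹ • gradient h z) y := by
  have h1 := hh.differentiableAt_gradient
  exact ((h1.norm ℝ hh.gradient_ne_zero).inv (norm_ne_zero_iff.2 hh.gradient_ne_zero)).smul h1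

/-- The normal field has constant length one near `y`, so its derivative is orthogonal to it. -/
lemma fderiv_normal_mem (hh : IsLocalDefiningFunction S y h) (v : Euc q) :
    fderiv ℝ (fun z => ‖gradient h z‖⁻¹ • gradient h z) y v ∈ hypersurfaceTangent h y := by
  have hd := hh.differentiableAt_normal.hasFDerivAt
  have hN := norm_ne_zero_iff.2 hh.gradient_ne_zero
  have h1 : (fun z => ⟪‖gradient h z‖⁻¹ • gradient h z, ‖gradient h z‖⁻¹ • gradient h z⟫_ℝ)
      =ᶠ[𝓝 y] fun _ => 1 := by
    filter_upwards [hh.differentiableAt_gradient.continuousAt.eventually_ne hh.gradient_ne_zero]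
      with z hz
    rw [real_inner_smul_left, real_inner_smul_right, real_inner_self_eq_norm_sq]
    have := norm_ne_zero_iff.2 hz
    field_simp
  have h2 := (hd.inner ℝ hd).unique ((hasFDerivAt_const (1 : ℝ) y).congr_of_eventuallyEq h1)
  have h3 := congrArg (fun L => L v) h2
  simp only [ContinuousLinearMap.comp_apply, ContinuousLinearMap.prod_apply,
    fderivInnerCLM_apply, _root_.zero_apply] at h3
  rw [real_inner_comm, ← two_mul, real_inner_smul_right, real_inner_comm] at h3
  change fderiv ℝ h y _ = 0
  rw [← inner_gradient]
  simpa [hN] using h3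

/-- Differentiating the normalizing factor yields a multiple of the gradient, which a tangent `u`
does not see. -/
lemma inner_fderiv_normal (hh : IsLocalDefiningFunction S y h) (v : Euc q) {u : Euc q}
    (hu : u ∈ hypersurfaceTangent h y) :
    ⟪fderiv ℝ (fun z => ‖gradient h z‖⁻¹ • gradient h z) y v, u⟫_ℝ
      = ‖fderiv ℝ h y‖⁻¹ * fderiv ℝ (fderiv ℝ h) y v u := by
  have h1 := hh.differentiableAt_gradient
  have h2 := ((h1.norm ℝ hh.gradient_ne_zero).inv
    (norm_ne_zero_iff.2 hh.gradient_ne_zero)).hasFDerivAt.smul h1.hasFDerivAt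
  rw [show (fun z => ‖gradient h z‖⁻¹ • gradient h z)
    = ((fun z => ‖gradient h z‖)⁻¹ • gradient h) from rfl, h2.fderiv]
  have hu0 : ⟪gradient h y, u⟫_ℝ = 0 := by rw [inner_gradient]; exact hu
  simp only [_root_.add_apply, _root_.smul_apply, ContinuousLinearMap.smulRight_apply,
    inner_add_left, real_inner_smul_left, hu0, mul_zero, add_zero, Pi.inv_apply, norm_gradient]
  rw [hh.inner_fderiv_gradient]

/-- The Weingarten map of a hypersurface. -/
def weingarten (hh : IsLocalDefiningFunction S y h) :
    hypersurfaceTangent h y →ₗ[ℝ] hypersurfaceTangent h y :=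
  ((fderiv ℝ (fun z => ‖gradient h z‖⁻¹ • gradient h z) y).toLinearMap.comp
    (hypersurfaceTangent h y).subtype).codRestrict _ fun v => hh.fderiv_normal_mem v

lemma inner_weingarten (hh : IsLocalDefiningFunction S y h) (v u : hypersurfaceTangent h y) :
    ⟪hh.weingarten v, u⟫_ℝ = ‖fderiv ℝ h y‖⁻¹ * fderiv ℝ (fderiv ℝ h) y v u :=
  hh.inner_fderiv_normal v u.2

lemma weingarten_isSymmetric (hh : IsLocalDefiningFunction S y h) :
    hh.weingarten.IsSymmetric := fun v u => by
  rw [real_inner_comm (hh.weingarten u), hh.inner_weingarten, hh.inner_weingarten,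
    (hh.smooth.self_of_nhds.isSymmSndFDerivAt (by simpa using ENat.LEInfty.out)) (v : Euc q) u]

end IsLocalDefiningFunction

/-- Expand `v` in an orthonormal eigenbasis: the quadratic form becomes a weighted sum of squares
with the eigenvalues as weights. -/
lemma LinearMap.IsSymmetric.inner_apply_self_bounds {V : Type*} [NormedAddCommGroup V]
    [InnerProductSpace ℝ V] [FiniteDimensional ℝ V] {T : V →ₗ[ℝ] V} (hT : T.IsSymmetric) {a b : ℝ}
    (h : ∀ μ v, v ≠ 0 → T v = μ • v → a ≤ μ ∧ μ ≤ b) (v : V) :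
    a * ‖v‖ ^ 2 ≤ ⟪T v, v⟫_ℝ ∧ ⟪T v, v⟫_ℝ ≤ b * ‖v‖ ^ 2 := by
  let B := hT.eigenvectorBasis rfl
  have hμ : ∀ i, a ≤ hT.eigenvalues rfl i ∧ hT.eigenvalues rfl i ≤ b := fun i =>
    h _ (B i) (B.orthonormal.ne_zero i) (hT.apply_eigenvectorBasis rfl i)
  have h1 : ⟪T v, v⟫_ℝ = ∑ i, hT.eigenvalues rfl i * ⟪B i, v⟫_ℝ ^ 2 := by
    rw [← B.sum_inner_mul_inner (T v) v]
    refine Finset.sum_congr rfl fun i _ => ?_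
    rw [hT, hT.apply_eigenvectorBasis rfl i, real_inner_smul_right, real_inner_comm]
    simp only [RCLike.ofReal_real_eq_id, id_eq, B]
    ring
  have h2 : ‖v‖ ^ 2 = ∑ i, ⟪B i, v⟫_ℝ ^ 2 := by
    rw [← real_inner_self_eq_norm_sq, ← B.sum_inner_mul_inner v v]
    refine Finset.sum_congr rfl fun i _ => ?_
    rw [real_inner_comm, sq]
  rw [h1, h2, Finset.mul_sum, Finset.mul_sum]
  exact ⟨Finset.sum_le_sum fun i _ => mul_le_mul_of_nonneg_right (hμ i).1 (sq_nonneg _),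
    Finset.sum_le_sum fun i _ => mul_le_mul_of_nonneg_right (hμ i).2 (sq_nonneg _)⟩

/-- Eigenvalues of the Weingarten map built from `h` are principal curvatures, so bounds on the
latter bound the tangential Hessian of `h`, up to the factor `|∇h|`. -/
lemma IsOuterDefiningFunction.snd_bounds {C : Set (Euc q)} (hh : IsOuterDefiningFunction C y h)
    {a b : ℝ} (hab : ∀ c, IsPrincipalCurvature C y c → a ≤ c ∧ c ≤ b)
    {v : Euc q} (hv : v ∈ hypersurfaceTangent h y) :
    a * ‖fderiv ℝ h y‖ * ‖v‖ ^ 2 ≤ fderiv ℝ (fderiv ℝ h) y v v ∧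
      fderiv ℝ (fderiv ℝ h) y v v ≤ b * ‖fderiv ℝ h y‖ * ‖v‖ ^ 2 := by
  have hd := hh.defining
  have hN : 0 < ‖fderiv ℝ h y‖ := norm_pos_iff.2 hd.regular
  have h1 := hd.weingarten_isSymmetric.inner_apply_self_bounds (a := a) (b := b)
    (fun μ u hu hμ => hab μ ⟨h, hh, u, u.2, fun h0 => hu (Subtype.ext h0),
      congrArg Subtype.val hμ⟩) ⟨v, hv⟩
  rw [hd.inner_weingarten] at h1
  change a * ‖v‖ ^ 2 ≤ _ ∧ _ ≤ b * ‖v‖ ^ 2 at h1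
  rw [inv_mul_eq_div, le_div_iff₀ hN, div_le_iff₀ hN] at h1
  constructor <;> nlinarith [h1.1, h1.2]

end PrincipalCurvatures

end

noncomputable section

/-! ### Ellipsoids -/

section Ellipsoids

variable {q : ℕ}

/-- The quadratic function whose zero set is the ellipsoid with semi-axes `a`. -/
def ellipsoidFunction (a : Fin q → ℝ) (x : Euc q) : ℝ := ∑ i, x i ^ 2 / a i ^ 2 - 1

/-- The symmetric bilinear form `∑ᵢ xᵢ yᵢ / aᵢ²`. -/
def ellipsoidForm (a : Fin q → ℝ) : Euc q →L[ℝ] Euc q →L[ℝ] ℝ :=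
  ∑ i, (1 / a i ^ 2) • ((EuclideanSpace.proj i : Euc q →L[ℝ] ℝ).smulRight
    (EuclideanSpace.proj i : Euc q →L[ℝ] ℝ))

lemma ellipsoidForm_apply (a : Fin q → ℝ) (x y : Euc q) :
    ellipsoidForm a x y = ∑ i, x i * y i / a i ^ 2 := by
  simp only [ellipsoidForm, sum_apply, _root_.smul_apply,
    ContinuousLinearMap.smulRight_apply, smul_eq_mul]
  exact Finset.sum_congr rfl fun i _ => by rw [EuclideanSpace.coe_proj]; ring

lemma ellipsoidFunction_eq (a : Fin q → ℝ) (x : Euc q) :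
    ellipsoidFunction a x = ellipsoidForm a x x - 1 := by
  rw [ellipsoidFunction, ellipsoidForm_apply]
  simp only [sq]

lemma fderiv_ellipsoidFunction (a : Fin q → ℝ) :
    fderiv ℝ (ellipsoidFunction a) = fun x => (2 : ℝ) • ellipsoidForm a x := by
  ext x v
  have h1 := (((ellipsoidForm a).hasFDerivAt (x := x)).clm_apply (hasFDerivAt_id x)).sub_const 1
  have h2 : ellipsoidFunction a = fun x => ellipsoidForm a x (id x) - 1 :=
    funext (ellipsoidFunction_eq a)
  have h3 : ellipsoidForm a v x = ellipsoidForm a x v := by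
    simp only [ellipsoidForm_apply, mul_comm]
  rw [h2, h1.fderiv]
  simp only [_root_.add_apply, ContinuousLinearMap.comp_apply, ContinuousLinearMap.flip_apply,
    _root_.smul_apply, ContinuousLinearMap.id_apply, id_eq, h3, smul_eq_mul]
  ring

lemma fderiv_fderiv_ellipsoidFunction (a : Fin q → ℝ) (x : Euc q) :
    fderiv ℝ (fderiv ℝ (ellipsoidFunction a)) x = (2 : ℝ) • ellipsoidForm a := by
  rw [fderiv_ellipsoidFunction]
  exact ((2 : ℝ) • ellipsoidForm a).fderiv

variable {a : Fin q → ℝ} {x : Euc q}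

lemma isLocalDefiningFunction_ellipsoid (hx : x ∈ ellipsoid a) :
    IsLocalDefiningFunction (ellipsoid a) x (ellipsoidFunction a) where
  smooth := .of_forall fun z => by
    unfold ellipsoidFunction
    fun_prop
  zero := sub_eq_zero.2 hx
  regular h0 := by
    have h1 := congrArg (fun L => L x) h0
    have h2 := ellipsoidFunction_eq a x
    have h3 : ellipsoidFunction a x = 0 := sub_eq_zero.2 hx
    rw [fderiv_ellipsoidFunction] at h1
    simp only [_root_.smul_apply, _root_.zero_apply, smul_eq_mul] at h1
    linarith
  mem_iff := .of_forall fun z => sub_eq_zero.symm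

/-- Test the derivative on half the gradient, `w = (x_i / a_i²)`. On the ellipsoid `∑ x_i² / a_i⁴ ≥
b⁻² ∑ x_i² / a_i² = b⁻²`, so `‖w‖ ≥ 1 / b`. -/
lemma two_div_le_norm_fderiv_ellipsoidFunction (ha : ∀ i, 0 < a i) (hx : x ∈ ellipsoid a) {b : ℝ}
    (hb : ∀ i, a i ≤ b) : 2 / b ≤ ‖fderiv ℝ (ellipsoidFunction a) x‖ := by
  set w : Euc q := WithLp.toLp 2 fun i => x i / a i ^ 2 with hw
  have hn : ‖w‖ ^ 2 = ∑ i, x i ^ 2 / a i ^ 4 := by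
    rw [EuclideanSpace.real_norm_sq_eq]
    exact Finset.sum_congr rfl fun i _ => by simp only [hw]; ring
  have hL : fderiv ℝ (ellipsoidFunction a) x w = 2 * ‖w‖ ^ 2 := by
    rw [fderiv_ellipsoidFunction, hn, _root_.smul_apply, ellipsoidForm_apply, smul_eq_mul]
    congr 1
    exact Finset.sum_congr rfl fun i _ => by simp only [hw]; ring
  obtain ⟨i₀⟩ : Nonempty (Fin q) := by
    by_contra hq
    rw [not_nonempty_iff] at hq
    simp [ellipsoid] at hx
  have hb0 : 0 < b := (ha i₀).trans_le (hb i₀)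
  have hlow : (1 / b) ^ 2 ≤ ‖w‖ ^ 2 := by
    rw [hn, div_pow, one_pow, ← show ∑ i, x i ^ 2 / a i ^ 2 = 1 from hx, Finset.sum_div]
    refine Finset.sum_le_sum fun i _ => ?_
    have h1 := ha i
    rw [div_div]
    refine div_le_div_of_nonneg_left (sq_nonneg _) (by positivity) ?_
    have h2 : a i ^ 2 ≤ b ^ 2 := pow_le_pow_left₀ h1.le (hb i) 2
    nlinarith [sq_nonneg (a i)]
  have hlow' : 1 / b ≤ ‖w‖ := le_of_sq_le_sq hlow (norm_nonneg _)
  have hwpos : 0 < ‖w‖ := (by positivity : 0 < 1 / b).trans_le hlow'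
  have h1 := (le_abs_self _).trans ((fderiv ℝ (ellipsoidFunction a) x).le_opNorm w)
  rw [hL] at h1
  have h2 : 2 * ‖w‖ ≤ ‖fderiv ℝ (ellipsoidFunction a) x‖ := by
    refine le_of_mul_le_mul_right ?_ hwpos
    linarith
  calc 2 / b = 2 * (1 / b) := by ring
    _ ≤ 2 * ‖w‖ := by linarith
    _ ≤ _ := h2

lemma ellipsoidForm_self_le {m : ℝ} (hm : 0 < m) (hm' : ∀ i, m ≤ a i) (v : Euc q) :
    ellipsoidForm a v v ≤ 1 / m ^ 2 * ‖v‖ ^ 2 := by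
  rw [ellipsoidForm_apply, EuclideanSpace.real_norm_sq_eq, Finset.mul_sum]
  refine Finset.sum_le_sum fun i _ => ?_
  have h2 : m ^ 2 ≤ a i ^ 2 := pow_le_pow_left₀ hm.le (hm' i) 2
  rw [one_div_mul_eq_div, ← sq]
  exact div_le_div_of_nonneg_left (sq_nonneg _) (by positivity) h2

end Ellipsoids

/-! ### The instability criteria for convex hypersurfaces and ellipsoids -/

section Instability

variable {k q : ℕ} {M : Type*} [TopologicalSpace M] [ChartedSpace (Euc k) M]
  [IsManifold (𝓡 k) ∞ M] {g : RiemMetric k M} {f : M → Euc q}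

lemma isPhiSSU_of_convex {C : Set (Euc q)} (hC : IsSmoothConvexBody C)
    (hpos : ∀ y ∈ frontier C, ∀ c : ℝ, IsPrincipalCurvature C y c → 0 < c)
    (hM : IsMinimalSubmanifold (frontier C) g f)
    (hR : ∀ (p : M) (x : TangentSpace (𝓡 k) p), g.inner p x x = 1 →
      ∃ c : ℝ, IsMaxPrincipalCurvature C (f p) c ∧ 3 / 4 * (k : ℝ) * c ^ 2 < ricci g p x x) :
    IsPhiSSU g := by
  refine ⟨q, f, hM.isometric, fun p e he x hx => ?_⟩
  obtain ⟨c, hc, hcR⟩ := hR p x hx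
  obtain ⟨h, hh⟩ := hC.smooth_boundary (f p) (hM.mem p)
  have hb := fun v => hh.snd_bounds (a := 0) (b := c) (v := v) fun d hd =>
    ⟨(hpos _ (hM.mem p) d hd).le, hc.2 hd⟩
  exact phiFunctional_neg hM hh.defining (fun v hv => by simpa using (hb v hv).1)
    (fun v hv => (hb v hv).2) he hx hcR

/-- Positivity of `m` is asked only when `M` has a point: for `q = 0` the infimum of the semi-axes
is the default value `0`, but then the ellipsoid, and with it `M`, is empty. -/
lemma isPhiSSU_of_ellipsoid {a : Fin q → ℝ} {m b : ℝ} (hm : M → 0 < m)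
    (hm' : ∀ i, m ≤ a i) (hb : ∀ i, a i ≤ b) (hM : IsMinimalSubmanifold (ellipsoid a) g f)
    (hR : ∀ (p : M) (x : TangentSpace (𝓡 k) p), g.inner p x x = 1 →
      3 / 4 * (b ^ 2 / m ^ 4) * (k : ℝ) < ricci g p x x) :
    IsPhiSSU g := by
  refine ⟨q, f, hM.isometric, fun p e he x hx => ?_⟩
  have hm0 := hm p
  have ha : ∀ i, 0 < a i := fun i => hm0.trans_le (hm' i)
  have hN := two_div_le_norm_fderiv_ellipsoidFunction ha (hM.mem p) hb
  obtain ⟨i₀⟩ : Nonempty (Fin q) := by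
    by_contra hq
    rw [not_nonempty_iff] at hq
    simpa [ellipsoid] using hM.mem p
  have hb0 : 0 < b := (ha i₀).trans_le (hb i₀)
  -- The Hessian is at most `2 / m²` and the gradient at least `2 / b`; their quotient is `c`, and
  -- `c²` is the constant in `hR`.
  refine phiFunctional_neg hM (isLocalDefiningFunction_ellipsoid (hM.mem p)) (c := b / m ^ 2)
    (fun v _ => ?_) (fun v _ => ?_) he hx ?_
  · rw [fderiv_fderiv_ellipsoidFunction, _root_.smul_apply, _root_.smul_apply,
      ellipsoidForm_apply, smul_eq_mul]
    exact mul_nonneg zero_le_two (Finset.sum_nonneg fun i _ =>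
      div_nonneg (mul_self_nonneg _) (sq_nonneg _))
  · rw [fderiv_fderiv_ellipsoidFunction, _root_.smul_apply, _root_.smul_apply, smul_eq_mul]
    calc 2 * ellipsoidForm a v v ≤ 2 * (1 / m ^ 2 * ‖v‖ ^ 2) := by
          linarith [ellipsoidForm_self_le hm0 hm' v]
      _ = b / m ^ 2 * (2 / b) * ‖v‖ ^ 2 := by field_simp
      _ ≤ _ := by gcongr
  · refine lt_of_eq_of_lt ?_ (hR p x hx)
    rw [div_pow, ← pow_mul]
    ring

lemma sphere_eq_ellipsoid (q : ℕ) : Metric.sphere (0 : Euc q) 1 = ellipsoid fun _ => 1 := by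
  ext x
  rw [mem_sphere_zero_iff_norm, ← sq_eq_sq₀ (norm_nonneg x) zero_le_one,
    EuclideanSpace.real_norm_sq_eq]
  simp [ellipsoid]

end Instability

end
theorem theorem5p3 {k q : ℕ} {M : Type*} [TopologicalSpace M] [ChartedSpace (Euc k) M]
    [IsManifold (𝓡 k) ∞ M] [T2Space M] [CompactSpace M] (g : RiemMetric k M) (f : M → Euc q) :
    -- compact convex hypersurfaces
    (∀ C : Set (Euc q), IsSmoothConvexBody C →
      (∀ y ∈ frontier C, ∀ c : ℝ, IsPrincipalCurvature C y c → 0 < c) →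
      IsMinimalSubmanifold (frontier C) g f →
      (∀ (p : M) (x : TangentSpace (𝓡 k) p), g.inner p x x = 1 →
        ∃ c : ℝ, IsMaxPrincipalCurvature C (f p) c ∧ 3 / 4 * (k : ℝ) * c ^ 2 < ricci g p x x) →
      IsPhiSSU g) ∧
    -- ellipsoids
    (∀ a : Fin q → ℝ, (∀ i, 0 < a i) →
      IsMinimalSubmanifold (ellipsoid a) g f →
      (∀ (p : M) (x : TangentSpace (𝓡 k) p), g.inner p x x = 1 →
        3 / 4 * ((⨆ i, a i) ^ 2 / (⨅ i, a i) ^ 4) * (k : ℝ) < ricci g p x x) →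
      IsPhiSSU g) ∧
    -- the unit sphere
    (IsMinimalSubmanifold (Metric.sphere (0 : Euc q) 1) g f →
      (∀ (p : M) (x : TangentSpace (𝓡 k) p), g.inner p x x = 1 →
        3 / 4 * (k : ℝ) < ricci g p x x) →
      IsPhiSSU g) := by
  refine ⟨fun C hC hpos hM hR => isPhiSSU_of_convex hC hpos hM hR, fun a ha hM hR => ?_,
    fun hM hR => ?_⟩
  · refine isPhiSSU_of_ellipsoid (m := ⨅ i, a i) (b := ⨆ i, a i) (fun p => ?_)
      (fun i => ciInf_le (Set.finite_range a).bddBelow i)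
      (fun i => le_ciSup (Set.finite_range a).bddAbove i) hM hR
    -- For `q = 0` the defining equation of the ellipsoid reads `0 = 1`, so a point of `M` excludes
    -- this case and the infimum is attained.
    obtain ⟨i₀⟩ : Nonempty (Fin q) := by
      by_contra hq
      rw [not_nonempty_iff] at hq
      simpa [ellipsoid] using hM.mem p
    have : Nonempty (Fin q) := ⟨i₀⟩
    obtain ⟨i, hi⟩ := exists_eq_ciInf_of_finite (f := a)
    exact hi ▸ ha i
  · rw [sphere_eq_ellipsoid] at hM
    exact isPhiSSU_of_ellipsoid (m := 1) (b := 1) (fun _ => one_pos) (fun _ => le_rfl)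
      (fun _ => le_rfl) hM (fun p x hx => by simpa using hR p x hx)
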